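/- Let $\mathbb{N}=\{0,1,2,\dots\}$. Let $\beta\in\mathbb{Z}$ be such that $-\beta$ is not a perfect square (equivalently, $f(x)=x^2+\beta$ is irreducible in $\mathbb{Z}[x]$), let $a,b\in\mathbb{Q}$ with $0\le a<b$, and let $c,d\in\mathbb{N}$ with $c\ge 1$. For $n\in\mathbb{N}$ put $$I(n)=\{k\in\mathbb{N} : an\le k\le bn\}\cap\{cm+d : m\in\mathbb{N}\},\qquad F_n=\prod_{k\in I(n)}(k^2+\beta).$$ Then for every $M\in\mathbb{N}$ there is an effectively computable bound $B\in\mathbb{N}$ such that for every integer $n>B$ there is a prime $p>Mn$ that divides $F_n$. Here "effectively computable" means that there is a single total computable function which, given $M$, $\beta$, $a$, $b$, $c$, $d$ (the rational numbers $a,b$ being given by their numerators and denominators in lowest terms), returns such a bound $B$. -/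

import Mathlib

namespace QuadraticProduct

open Classical in
/-- The index set `{k ∈ ℕ : a n ≤ k ≤ b n} ∩ (c ℕ + d)`, where `0 ∈ ℕ`, as a finite set.
The range only bounds the search: see `mem_indexSet`. -/
noncomputable def indexSet (a b : ℚ) (c d n : ℕ) : Finset ℕ :=
  (Finset.range (⌊b * n⌋₊ + 1)).filter
    (fun k => a * n ≤ (k : ℚ) ∧ (k : ℚ) ≤ b * n ∧ ∃ m : ℕ, k = c * m + d)

theorem mem_indexSet (a b : ℚ) (c d n k : ℕ) :
    k ∈ indexSet a b c d n ↔
      a * n ≤ (k : ℚ) ∧ (k : ℚ) ≤ b * n ∧ ∃ m : ℕ, k = c * m + d := by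
  simp only [indexSet, Finset.mem_filter, Finset.mem_range, and_iff_right_iff_imp]
  rintro ⟨-, h, -⟩
  exact Nat.lt_succ_of_le (Nat.le_floor h)

/-- The product `F_n = ∏ (k ^ 2 + β)` over the index set above. -/
noncomputable def F (β : ℤ) (a b : ℚ) (c d n : ℕ) : ℤ :=
  ∏ k ∈ indexSet a b c d n, ((k : ℤ) ^ 2 + β)

/-- A rational number presented to an algorithm as its numerator and denominator in lowest
terms. -/
def ratCode (q : ℚ) : ℤ × ℕ := (q.num, q.den)

end QuadraticProduct

/-!
The proof is Chebyshev's argument for the largest prime factor of `∏ (k ^ 2 + 1)`, arranged so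
that the only non-explicit input is one divergent series.

Suppose that every prime factor of `F_n` is at most `M n`, and let `L = (b - a) n / c`, which is
the size of the index set up to `O(1)`. On the one hand `log |F_n| ≥ 2 L log n - O(n)`, since each
factor is comparable to `k ^ 2` and `log (n ^ n / n!) ≤ n` (`le_sum_log_natAbs`,
`le_card_indexSet`). On the other hand `log |F_n| = ∑ Λ(e) #{k : e ∣ k ^ 2 + β}`
(`sum_log_eq_sum_vonMangoldt`). A prime `e` outside the divisors of `2 β c` divides `k ^ 2 + β`
for at most `2 (L / e + 1)` indices, and for none of them when it is inert; Mertens' upper bound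
`∑ log p / p ≤ log y + O(1)` then bounds the contribution of the primes by
`2 L (log n - T(n)) + O(n)`, where `T(n)` is the sum of `log p / p` over the inert primes `p ≤ n`
(`inertSum`). The divisors of `2 β c` and the proper prime powers contribute `O(n)`, because the
roots of `x ^ 2 + β` modulo a prime power fall into two classes modulo a number smaller by a factor
at most `4 |β|` (`pow_dvd_sub_or_pow_dvd_add`), and because `ψ(x) - θ(x) = O(√x)`. The terms
`2 L log n` cancel and `T(n)` is bounded by an absolute constant times a fixed power of the height
of the data (`exists_inertSum_le`).

Since `-β` is not a square, quadratic reciprocity yields a residue class modulo `4 |β|` consisting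
of inert primes, and Dirichlet's theorem makes `T(n)` tend to infinity (`tendsto_inertSum`). No rate
is needed for effectiveness: `T` is monotone, so any `N` at which it exceeds the bound above is
valid, and such an `N` is found by a search whose test is an inequality between natural numbers,
obtained by rounding `log p` and `1 / p` (`scaledInertSum`).
-/

namespace QuadraticProduct

open Finset ArithmeticFunction
open scoped NumberTheorySymbols

/-! ### Residue classes and roots modulo prime powers -/

lemma card_le_of_modEq {I : Finset ℕ} {u v : ℝ} {m : ℕ} (hm : 0 < m) (huv : u ≤ v)
    (hI : ∀ k ∈ I, u ≤ k ∧ (k : ℝ) ≤ v) (hmod : ∀ k ∈ I, ∀ l ∈ I, k ≡ l [MOD m]) :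
    (#I : ℝ) ≤ (v - u) / m + 1 := by
  have hm' : (0 : ℝ) < m := by exact_mod_cast hm
  have h0 : 0 ≤ (v - u) / m := div_nonneg (sub_nonneg.2 huv) hm'.le
  rcases I.eq_empty_or_nonempty with rfl | hne
  · simpa using by linarith
  -- `k ↦ (k - k₀) / m`, for the least element `k₀`, is injective on `I`.
  set k₀ := I.min' hne
  have hk₀ : k₀ ∈ I := I.min'_mem hne
  have hdvd : ∀ k ∈ I, k₀ ≤ k ∧ m ∣ k - k₀ := fun k hk =>
    ⟨I.min'_le k hk, (Nat.modEq_iff_dvd' (I.min'_le k hk)).1 (hmod _ hk₀ _ hk)⟩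
  have hcard : #I ≤ #(range (⌊(v - u) / m⌋₊ + 1)) := by
    refine card_le_card_of_injOn (fun k => (k - k₀) / m) (fun k hk => ?_) (fun k hk l hl h => ?_)
    · have hk : k ∈ I := hk
      simp only [coe_range, Set.mem_Iio]
      refine Nat.lt_succ_of_le (Nat.le_floor ?_)
      rw [Nat.cast_div (hdvd k hk).2 hm'.ne', Nat.cast_sub (hdvd k hk).1]
      gcongr
      · exact (hI k hk).2
      · exact (hI _ hk₀).1
    · have hk : k ∈ I := hk
      have hl : l ∈ I := hl
      obtain ⟨hk1, hk2⟩ := hdvd k hk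
      obtain ⟨hl1, hl2⟩ := hdvd l hl
      have := Nat.div_mul_cancel hk2
      have h2 := Nat.div_mul_cancel hl2
      have h : (k - k₀) / m = (l - k₀) / m := h
      rw [h] at this
      omega
  rw [card_range] at hcard
  calc (#I : ℝ) ≤ ⌊(v - u) / m⌋₊ + 1 := by exact_mod_cast hcard
    _ ≤ _ := by gcongr; exact Nat.floor_le h0

/-- If `p ^ (m + n + 1)` divides `x * y`, the exponent is too large to be split as at most `m` in
`x` and at most `n` in `y`. -/
lemma _root_.Prime.pow_dvd_or_pow_dvd_of_pow_dvd_mul {R : Type*} [CommRing R] [IsDomain R]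
    {p x y : R} (hp : Prime p) {m n : ℕ} (h : p ^ (m + n + 1) ∣ x * y) :
    p ^ (m + 1) ∣ x ∨ p ^ (n + 1) ∣ y := by
  rw [pow_dvd_iff_le_emultiplicity, emultiplicity_mul hp] at h
  simp_rw [pow_dvd_iff_le_emultiplicity]
  by_contra! hc
  obtain ⟨h1, h2⟩ := hc
  lift emultiplicity p x to ℕ using h1.ne_top with u
  lift emultiplicity p y to ℕ using h2.ne_top with v
  norm_cast at *
  omega

/-- Any two square roots of `-β` modulo a prime power `p ^ j` agree up to sign modulo
`p ^ (j - t)`, where `p ^ t` exactly divides `4 β`. -/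
lemma pow_dvd_sub_or_pow_dvd_add {p j t : ℕ} (hp : p.Prime) {β x y : ℤ}
    (ht : ¬ (p : ℤ) ^ (t + 1) ∣ 4 * β) (hx : (p : ℤ) ^ j ∣ x ^ 2 + β)
    (hy : (p : ℤ) ^ j ∣ y ^ 2 + β) :
    (p : ℤ) ^ (j - t) ∣ x - y ∨ (p : ℤ) ^ (j - t) ∣ x + y := by
  have hpp : Prime (p : ℤ) := Nat.prime_iff_prime_int.1 hp
  by_contra! hcon
  obtain ⟨h1, h2⟩ := hcon
  have hjt : t < j := by
    by_contra! h
    rw [Nat.sub_eq_zero_of_le h] at h1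
    simp at h1
  have hprod : (p : ℤ) ^ j ∣ (x - y) * (x + y) := by
    convert! dvd_sub hx hy using 1; ring
  -- Neither factor takes `p ^ (j - t)`, so both are divisible by `p ^ (t + 1)`, and so is `2 x`.
  have hj : j = (j - t - 1) + t + 1 := by omega
  have hj' : j - t = (j - t - 1) + 1 := by omega
  rw [hj'] at h1 h2
  rw [hj] at hprod
  have e1 := (hpp.pow_dvd_or_pow_dvd_of_pow_dvd_mul hprod).resolve_left h1
  have e2 := (hpp.pow_dvd_or_pow_dvd_of_pow_dvd_mul (mul_comm (x - y) _ ▸ hprod)).resolve_left h2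
  apply ht
  have h3 : (p : ℤ) ^ (t + 1) ∣ 4 * (x ^ 2 + β) :=
    Dvd.dvd.mul_left ((pow_dvd_pow _ hjt).trans hx) _
  have h4 : (p : ℤ) ^ (t + 1) ∣ 2 * x := by
    convert! dvd_add e1 e2 using 1; ring
  have := dvd_sub h3 (h4.mul_right (2 * x))
  convert! this using 1; ring

/-- The number of `k ∈ I` for which `e` divides `k ^ 2 + β`. -/
def rootCount (β : ℤ) (I : Finset ℕ) (e : ℕ) : ℕ :=
  #(I.filter fun k : ℕ => (e : ℤ) ∣ (k : ℤ) ^ 2 + β)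

/-- If the roots of `x ^ 2 + β` modulo `e` agree up to sign modulo `m`, then all of them in `I` lie
in two residue classes modulo `c * m`. -/
lemma rootCount_le_of_two_classes {β : ℤ} {I : Finset ℕ} {u v : ℝ} {c m e : ℕ} (hc : 0 < c)
    (hm : 0 < m) (hcm : c.Coprime m) (huv : u ≤ v) (hI : ∀ k ∈ I, u ≤ k ∧ (k : ℝ) ≤ v)
    (hmod : ∀ k ∈ I, ∀ l ∈ I, k ≡ l [MOD c])
    (hroot : ∀ x y : ℤ, (e : ℤ) ∣ x ^ 2 + β → (e : ℤ) ∣ y ^ 2 + β →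
      (m : ℤ) ∣ x - y ∨ (m : ℤ) ∣ x + y) :
    (rootCount β I e : ℝ) ≤ 2 * ((v - u) / (c * m) + 1) := by
  have h0 : 0 ≤ (v - u) / (c * m) := div_nonneg (sub_nonneg.2 huv) (by positivity)
  rcases (I.filter fun k : ℕ => (e : ℤ) ∣ (k : ℤ) ^ 2 + β).eq_empty_or_nonempty with h | ⟨k₀, hk₀⟩
  · rw [rootCount, h]
    simpa using by linarith
  have hk₀' := (mem_filter.1 hk₀).2
  have hclass : ∀ r : ℤ, (#(I.filter fun k : ℕ => (m : ℤ) ∣ (k : ℤ) - r) : ℝ) ≤ (v - u) / (c * m) + 1 := by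
    intro r
    have := card_le_of_modEq (I := (I.filter fun k : ℕ => (m : ℤ) ∣ (k : ℤ) - r)) (Nat.mul_pos hc hm) huv
      (fun k hk => hI k (mem_filter.1 hk).1) (fun k hk l hl => ?_)
    · simpa using this
    · rw [mem_filter] at hk hl
      refine (Nat.modEq_and_modEq_iff_modEq_mul hcm).1 ⟨hmod k hk.1 l hl.1, ?_⟩
      rw [← Int.natCast_modEq_iff, Int.modEq_comm, Int.modEq_iff_dvd]
      convert! dvd_sub hk.2 hl.2 using 1; ring
  have hsub : (I.filter fun k : ℕ => (e : ℤ) ∣ (k : ℤ) ^ 2 + β) ⊆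
      (I.filter fun k : ℕ => (m : ℤ) ∣ (k : ℤ) - k₀) ∪ (I.filter fun k : ℕ => (m : ℤ) ∣ (k : ℤ) - (-k₀)) := by
    intro k hk
    rw [mem_filter] at hk
    rw [mem_union, mem_filter, mem_filter, sub_neg_eq_add]
    rcases hroot k k₀ hk.2 hk₀' with h | h
    · exact Or.inl ⟨hk.1, h⟩
    · exact Or.inr ⟨hk.1, h⟩
  calc (rootCount β I e : ℝ)
      ≤ #(I.filter fun k : ℕ => (m : ℤ) ∣ (k : ℤ) - k₀) + #(I.filter fun k : ℕ => (m : ℤ) ∣ (k : ℤ) - (-k₀)) := by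
        exact_mod_cast (card_le_card hsub).trans (card_union_le _ _)
    _ ≤ ((v - u) / (c * m) + 1) + ((v - u) / (c * m) + 1) := add_le_add (hclass _) (hclass _)
    _ = _ := by ring

/-- The sharp count, with the factor `1 / c` gained from the progression, for primes not dividing
`2 β c`. -/
lemma rootCount_prime_le {β : ℤ} {I : Finset ℕ} {u v : ℝ} {c p : ℕ} (hc : 0 < c)
    (hp : p.Prime) (hbad : ¬ p ∣ 2 * β.natAbs * c) (huv : u ≤ v)
    (hI : ∀ k ∈ I, u ≤ k ∧ (k : ℝ) ≤ v) (hmod : ∀ k ∈ I, ∀ l ∈ I, k ≡ l [MOD c]) :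
    (rootCount β I p : ℝ) ≤ 2 * ((v - u) / (c * p) + 1) := by
  rw [hp.dvd_mul, hp.dvd_mul, not_or, not_or] at hbad
  refine rootCount_le_of_two_classes hc hp.pos
    ((Nat.coprime_comm.1 ((Nat.Prime.coprime_iff_not_dvd hp).2 hbad.2))) huv hI hmod ?_
  intro x y hx hy
  refine (Nat.prime_iff_prime_int.1 hp).dvd_or_dvd ?_
  convert! dvd_sub hx hy using 1; ring

/-- A cruder count, valid for all prime powers and uniform in the exponent. -/
lemma rootCount_primePow_le {β : ℤ} (hβ : β ≠ 0) {I : Finset ℕ} {v : ℝ} {e : ℕ}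
    (he : IsPrimePow e) (hv : 0 ≤ v) (hI : ∀ k ∈ I, (k : ℝ) ≤ v) :
    (rootCount β I e : ℝ) ≤ 2 * (4 * β.natAbs * v / e + 1) := by
  obtain ⟨p, j, hp, -, rfl⟩ := (isPrimePow_nat_iff _).1 he
  have hfin : FiniteMultiplicity (p : ℤ) (4 * β) :=
    Int.finiteMultiplicity_iff.2 ⟨by simpa using hp.ne_one, by simpa using hβ⟩
  have ht : ¬ (p : ℤ) ^ (multiplicity (p : ℤ) (4 * β) + 1) ∣ 4 * β :=
    hfin.not_pow_dvd_of_multiplicity_lt (Nat.lt_succ_self _)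
  have ht' : (p : ℤ) ^ (multiplicity (p : ℤ) (4 * β)) ∣ 4 * β := pow_multiplicity_dvd _ _
  set s := multiplicity (p : ℤ) (4 * β)
  have hps : p ^ s ≤ 4 * β.natAbs := by
    refine Nat.le_of_dvd (by positivity) ?_
    have := Int.natAbs_dvd_natAbs.2 ht'
    simpa [Int.natAbs_pow, Int.natAbs_mul] using this
  have hpj : p ^ j ≤ p ^ (j - s) * p ^ s := by
    rw [← pow_add]
    exact Nat.pow_le_pow_right hp.pos (by omega)
  have hle : ((p ^ j : ℕ) : ℝ) ≤ ((p ^ (j - s) : ℕ) : ℝ) * (4 * β.natAbs) := by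
    exact_mod_cast hpj.trans (Nat.mul_le_mul_left _ hps)
  have h1 : (0 : ℝ) < ((p ^ (j - s) : ℕ) : ℝ) := by exact_mod_cast pow_pos hp.pos _
  have h2 : (0 : ℝ) < ((p ^ j : ℕ) : ℝ) := by exact_mod_cast pow_pos hp.pos _
  refine (rootCount_le_of_two_classes (u := 0) (v := v) one_pos (pow_pos hp.pos (j - s))
    (Nat.coprime_one_left _) hv (fun k hk => ⟨by positivity, hI k hk⟩)
    (fun k _ l _ => Nat.modEq_one) ?_).trans ?_
  · intro x y hx hy
    push_cast at hx hy ⊢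
    exact pow_dvd_sub_or_pow_dvd_add hp ht hx hy
  · have : (v - 0) / (((1 : ℕ) : ℝ) * ((p ^ (j - s) : ℕ) : ℝ)) ≤
        4 * β.natAbs * v / ((p ^ j : ℕ) : ℝ) := by
      rw [sub_zero, Nat.cast_one, one_mul, div_le_div_iff₀ h1 h2]
      nlinarith
    linarith

/-! ### Summing the von Mangoldt function over divisors -/

/-- Double counting in `log m = ∑ Λ e`, the sum being over the divisors `e` of `m`. -/
lemma sum_log_eq_sum_vonMangoldt (I : Finset ℕ) (g : ℕ → ℕ) (Z : ℕ)
    (hpos : ∀ k ∈ I, 0 < g k) (hZ : ∀ k ∈ I, g k ≤ Z) :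
    ∑ k ∈ I, Real.log (g k) = ∑ e ∈ Ioc 0 Z, Λ e * #{k ∈ I | e ∣ g k} := by
  have h1 : ∀ k ∈ I, Real.log (g k) = ∑ e ∈ Ioc 0 Z, if e ∣ g k then Λ e else 0 := by
    intro k hk
    rw [← vonMangoldt_sum, ← sum_filter]
    refine sum_congr ?_ fun _ _ => rfl
    ext e
    simp only [Nat.mem_divisors, mem_filter, mem_Ioc]
    constructor
    · rintro ⟨h, h0⟩
      exact ⟨⟨Nat.pos_of_dvd_of_pos h (hpos k hk), (Nat.le_of_dvd (hpos k hk) h).trans (hZ k hk)⟩, h⟩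
    · rintro ⟨-, h⟩
      exact ⟨h, (hpos k hk).ne'⟩
  rw [sum_congr rfl h1, sum_comm]
  refine sum_congr rfl fun e _ => ?_
  rw [← sum_filter, sum_const, nsmul_eq_mul, mul_comm]

/-- The upper half of Mertens' first theorem. -/
lemma sum_log_div_prime_le {n : ℕ} (hn : 0 < n) :
    ∑ p ∈ Ioc 0 n with p.Prime, Real.log p / p ≤ Real.log n + Real.log 4 := by
  have hn' : (0 : ℝ) < n := by exact_mod_cast hn
  have hlogfac : ∑ k ∈ Ioc 0 n, Real.log k ≤ n * Real.log n := by
    calc ∑ k ∈ Ioc 0 n, Real.log k ≤ ∑ k ∈ Ioc 0 n, Real.log n := by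
          refine sum_le_sum fun k hk => ?_
          rw [mem_Ioc] at hk
          exact Real.log_le_log (by exact_mod_cast hk.1) (by exact_mod_cast hk.2)
      _ = _ := by simp
  have hle : ∑ p ∈ Ioc 0 n with p.Prime, Real.log p * (n / p - 1) ≤ ∑ k ∈ Ioc 0 n, Real.log k := by
    refine le_of_le_of_eq ?_ (sum_log_eq_sum_vonMangoldt (Ioc 0 n) id n (fun k hk => (mem_Ioc.1 hk).1)
      (fun k hk => (mem_Ioc.1 hk).2)).symm
    rw [sum_filter]
    refine sum_le_sum fun e he => ?_
    split_ifs with hp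
    · rw [vonMangoldt_apply_prime hp]
      gcongr
      simp only [id]
      rw [Nat.Ioc_filter_dvd_card_eq_div n e, sub_le_iff_le_add]
      exact (Nat.lt_floor_add_one _).le.trans_eq (by rw [Nat.floor_div_natCast, Nat.floor_natCast])
    · exact mul_nonneg vonMangoldt_nonneg (Nat.cast_nonneg _)
  have hθ := Chebyshev.theta_le_log4_mul_x hn'.le
  rw [Chebyshev.theta, Nat.floor_natCast] at hθ
  have hsplit : ∑ p ∈ Ioc 0 n with p.Prime, Real.log p * (n / p - 1) =
      n * ∑ p ∈ Ioc 0 n with p.Prime, Real.log p / p - ∑ p ∈ Ioc 0 n with p.Prime, Real.log p := by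
    rw [mul_sum, ← sum_sub_distrib]
    exact sum_congr rfl fun p _ => by ring
  rw [hsplit] at hle
  refine le_of_mul_le_mul_left ?_ hn'
  nlinarith

/-- The proper prime powers contribute a bounded amount to `∑ Λ e / e`. -/
lemma exists_sum_vonMangoldt_div_not_prime_le :
    ∃ C : ℝ, 0 ≤ C ∧ ∀ Z : ℕ, ∑ e ∈ Ioc 0 Z with ¬ e.Prime, Λ e / e ≤ C := by
  have hs := vonMangoldt.summable_residueClass_non_primes_div (q := 1) 0
  have hnn : ∀ n : ℕ, 0 ≤ (if n.Prime then 0 else vonMangoldt.residueClass (0 : ZMod 1) n) / n := by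
    intro n
    positivity [vonMangoldt.residueClass_nonneg (0 : ZMod 1) n]
  refine ⟨∑' n : ℕ, (if n.Prime then 0 else vonMangoldt.residueClass (0 : ZMod 1) n) / n,
    tsum_nonneg hnn, fun Z => ?_⟩
  refine le_trans (le_of_eq ?_) (hs.sum_le_tsum (Ioc 0 Z) fun n _ => hnn n)
  rw [sum_filter]
  refine sum_congr rfl fun e _ => ?_
  have : (e : ZMod 1) = 0 := Subsingleton.elim _ _
  split_ifs <;> simp_all

/-- A consequence of `log (n ^ n / n!) ≤ n`: the terms `log (n / k)` with `k > n` are negative, and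
those with `k ≤ n` are among the terms of `log (n ^ n / n!)`. -/
lemma card_mul_log_sub_le_sum_log {n : ℕ} (hn : 0 < n) {I : Finset ℕ} (hI : ∀ k ∈ I, 0 < k) :
    #I * Real.log n - n ≤ ∑ k ∈ I, Real.log k := by
  have hn' : (0 : ℝ) < n := by exact_mod_cast hn
  have hfac : ∑ k ∈ Ioc 0 n, (Real.log n - Real.log k) ≤ n := by
    have h1 : ∑ k ∈ Ioc 0 n, Real.log k = Real.log n.factorial := by
      rw [← Real.log_prod]
      · rw [← Finset.prod_Ico_id_eq_factorial, Nat.cast_prod]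
        rfl
      · intro k hk
        have := (mem_Ioc.1 hk).1
        positivity
    have h2 := Real.log_le_log (by positivity) (Real.pow_div_factorial_le_exp (n : ℝ) hn'.le n)
    rw [Real.log_exp, Real.log_div (by positivity) (by positivity), Real.log_pow] at h2
    rw [sum_sub_distrib, h1]
    simpa using h2
  have hle : ∑ k ∈ I, (Real.log n - Real.log k) ≤ ∑ k ∈ Ioc 0 n, (Real.log n - Real.log k) := by
    calc ∑ k ∈ I, (Real.log n - Real.log k)
        ≤ ∑ k ∈ I, if k ∈ Ioc 0 n then (Real.log n - Real.log k) else 0 := by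
          refine sum_le_sum fun k hk => ?_
          split_ifs with h
          · exact le_rfl
          · have : n < k := by
              by_contra! h'
              exact h (mem_Ioc.2 ⟨hI k hk, h'⟩)
            rw [sub_nonpos]
            exact Real.log_le_log hn' (by exact_mod_cast this.le)
      _ = ∑ k ∈ I ∩ Ioc 0 n, (Real.log n - Real.log k) := by
          rw [← sum_filter]; congr 1
      _ ≤ _ := by
          refine sum_le_sum_of_subset_of_nonneg inter_subset_right fun k hk _ => ?_
          rw [mem_Ioc] at hk
          rw [sub_nonneg]
          exact Real.log_le_log (by exact_mod_cast hk.1) (by exact_mod_cast hk.2)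
  rw [sum_sub_distrib, sum_const, nsmul_eq_mul] at hle
  linarith

/-! ### Inert primes and the upper bound for the product -/

/-- The prime `p` is inert for `β` when `x ^ 2 + β` has no root modulo `p`. -/
def IsInert (β : ℤ) (p : ℕ) : Prop :=
  p.Prime ∧ ∀ x < p, ¬ (p : ℤ) ∣ (x : ℤ) ^ 2 + β

lemma IsInert.not_dvd {β : ℤ} {p : ℕ} (h : IsInert β p) (k : ℤ) : ¬ (p : ℤ) ∣ k ^ 2 + β := by
  have hp : (0 : ℤ) < p := by exact_mod_cast h.1.pos
  have h1 : ((k % p).toNat : ℤ) = k % p := Int.toNat_of_nonneg (Int.emod_nonneg _ hp.ne')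
  intro hk
  refine h.2 (k % p).toNat ?_ ?_
  · have := Int.emod_lt_of_pos k hp
    omega
  · rw [h1]
    have : k % p ^ 1 ≡ k [ZMOD p] := by simpa using Int.mod_modEq k p
    rw [pow_one] at this
    exact (((this.pow 2).add_right β).dvd_iff).2 hk

lemma IsInert.rootCount_eq_zero {β : ℤ} {p : ℕ} (h : IsInert β p) (I : Finset ℕ) :
    rootCount β I p = 0 := by
  rw [rootCount, card_eq_zero, filter_eq_empty_iff]
  exact fun k _ => h.not_dvd k

open Classical in
/-- The sum of `log p / p` over the inert primes `p ≤ n`. -/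
noncomputable def inertSum (β : ℤ) (n : ℕ) : ℝ :=
  ∑ p ∈ Ioc 0 n with IsInert β p, Real.log p / p

lemma inertSum_mono (β : ℤ) : Monotone (inertSum β) := by
  classical
  intro m n hmn
  refine sum_le_sum_of_subset_of_nonneg (filter_subset_filter _ (Ioc_subset_Ioc_right hmn)) ?_
  intro p _ _
  exact div_nonneg (Real.log_natCast_nonneg _) (Nat.cast_nonneg _)

/-- Term by term estimate in the sum `∑ Λ e * rootCount β I e`. -/
lemma vonMangoldt_mul_rootCount_le {β : ℤ} (hβ : β ≠ 0) {I : Finset ℕ} {u v : ℝ} {c y e : ℕ}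
    (hc : 0 < c) (hu : 0 ≤ u) (huv : u ≤ v) (he : 0 < e) (hI : ∀ k ∈ I, u ≤ k ∧ (k : ℝ) ≤ v)
    (hmod : ∀ k ∈ I, ∀ l ∈ I, k ≡ l [MOD c])
    (hy : ∀ k ∈ I, ∀ p : ℕ, p.Prime → (p : ℤ) ∣ (k : ℤ) ^ 2 + β → p ≤ y) [DecidablePred (IsInert β)] :
    Λ e * rootCount β I e ≤
      (if e.Prime ∧ ¬ IsInert β e ∧ e ≤ y then
        2 * ((v - u) / c) * (Real.log e / e) + 2 * Real.log e else 0) +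
      (if e ∣ 2 * β.natAbs * c then Λ e * (8 * β.natAbs * v + 2) else 0) +
      (if ¬ e.Prime then 8 * β.natAbs * v * (Λ e / e) + 2 * Λ e else 0) := by
  have hv := hu.trans huv
  have he' : (0 : ℝ) < e := by exact_mod_cast he
  have he1 : (1 : ℝ) ≤ e := by exact_mod_cast he
  have hc' : (0 : ℝ) < c := by exact_mod_cast hc
  have hΛ : 0 ≤ Λ e := vonMangoldt_nonneg
  have hlog : 0 ≤ Real.log e := Real.log_natCast_nonneg _
  have hL : 0 ≤ (v - u) / c := div_nonneg (sub_nonneg.2 huv) hc'.le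
  have n1 : 0 ≤ if e.Prime ∧ ¬ IsInert β e ∧ e ≤ y then
        2 * ((v - u) / c) * (Real.log e / e) + 2 * Real.log e else 0 := by
    split_ifs <;> positivity
  have n2 : 0 ≤ if e ∣ 2 * β.natAbs * c then Λ e * (8 * β.natAbs * v + 2) else 0 := by
    split_ifs <;> positivity
  have n3 : 0 ≤ if ¬ e.Prime then 8 * β.natAbs * v * (Λ e / e) + 2 * Λ e else 0 := by
    split_ifs <;> positivity
  by_cases hp0 : IsPrimePow e
  swap
  · exact le_of_eq_of_le (by rw [vonMangoldt_eq_zero_iff.2 hp0, zero_mul])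
      (add_nonneg (add_nonneg n1 n2) n3)
  have hcrude := rootCount_primePow_le hβ hp0 hv fun k hk => (hI k hk).2
  by_cases hp : e.Prime
  · by_cases hbad : e ∣ 2 * β.natAbs * c
    · rw [if_pos hbad] at n2 ⊢
      have : (rootCount β I e : ℝ) ≤ 8 * β.natAbs * v + 2 := by
        refine hcrude.trans ?_
        have : 4 * β.natAbs * v / e ≤ 4 * β.natAbs * v := div_le_self (by positivity) he1
        linarith
      have := mul_le_mul_of_nonneg_left this hΛ
      linarith
    · by_cases hin : IsInert β e
      · rw [hin.rootCount_eq_zero, Nat.cast_zero, mul_zero]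
        exact add_nonneg (add_nonneg n1 n2) n3
      · by_cases hey : e ≤ y
        · rw [if_pos ⟨hp, hin, hey⟩] at n1 ⊢
          have := mul_le_mul_of_nonneg_left (rootCount_prime_le hc hp hbad huv hI hmod) hΛ
          rw [vonMangoldt_apply_prime hp] at this n2 n3 ⊢
          have h2 : Real.log e * (2 * ((v - u) / (c * e) + 1)) =
            2 * ((v - u) / c) * (Real.log e / e) + 2 * Real.log e := by
            field_simp
          linarith
        · have : rootCount β I e = 0 := by
            rw [rootCount, card_eq_zero, filter_eq_empty_iff]
            exact fun k hk h => hey (hy k hk e hp h)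
          rw [this, Nat.cast_zero, mul_zero]
          exact add_nonneg (add_nonneg n1 n2) n3
  · rw [if_pos hp] at n3 ⊢
    have := mul_le_mul_of_nonneg_left hcrude hΛ
    have h2 : Λ e * (2 * (4 * β.natAbs * v / e + 1)) = 8 * β.natAbs * v * (Λ e / e) + 2 * Λ e := by
      field_simp
      ring
    linarith

/-- Upper bound for the logarithm of `∏ (k ^ 2 + β)` when all its prime factors are at most `y`.
The three lines of the bound come from the primes up to `y` that are not inert, from the divisors
of `2 β c`, and from the proper prime powers. -/
lemma sum_log_natAbs_le {β : ℤ} (hβ : β ≠ 0) {I : Finset ℕ} {u v : ℝ} {c y Z : ℕ}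
    (hc : 0 < c) (hu : 0 ≤ u) (huv : u ≤ v) (hy0 : 0 < y) (hI : ∀ k ∈ I, u ≤ k ∧ (k : ℝ) ≤ v)
    (hmod : ∀ k ∈ I, ∀ l ∈ I, k ≡ l [MOD c])
    (hy : ∀ k ∈ I, ∀ p : ℕ, p.Prime → (p : ℤ) ∣ (k : ℤ) ^ 2 + β → p ≤ y)
    (hne : ∀ k ∈ I, (k : ℤ) ^ 2 + β ≠ 0) (hZ : ∀ k ∈ I, ((k : ℤ) ^ 2 + β).natAbs ≤ Z)
    {C : ℝ} (hC : ∑ e ∈ Ioc 0 Z with ¬ e.Prime, Λ e / e ≤ C) :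
    ∑ k ∈ I, Real.log (((k : ℤ) ^ 2 + β).natAbs) ≤
      2 * ((v - u) / c) * (Real.log y + Real.log 4 - inertSum β y) + 2 * (Real.log 4 * y)
      + Real.log ((2 * β.natAbs * c : ℕ) : ℝ) * (8 * β.natAbs * v + 2)
      + (8 * β.natAbs * v * C + 2 * (Chebyshev.psi Z - Chebyshev.theta Z)) := by
  classical
  have hv := hu.trans huv
  have hc' : (0 : ℝ) < c := by exact_mod_cast hc
  have hL : 0 ≤ (v - u) / c := div_nonneg (sub_nonneg.2 huv) hc'.le
  rw [sum_log_eq_sum_vonMangoldt I (fun k => ((k : ℤ) ^ 2 + β).natAbs) Z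
    (fun k hk => Int.natAbs_pos.2 (hne k hk)) hZ]
  have hcount : ∀ e : ℕ, #(I.filter fun k : ℕ => e ∣ ((k : ℤ) ^ 2 + β).natAbs) = rootCount β I e := by
    intro e
    simp only [rootCount, Int.natCast_dvd]
  simp only [hcount]
  refine (sum_le_sum fun e he =>
    vonMangoldt_mul_rootCount_le hβ hc hu huv (mem_Ioc.1 he).1 hI hmod hy).trans ?_
  rw [sum_add_distrib, sum_add_distrib]
  refine add_le_add (add_le_add ?_ ?_) ?_
  · have hsub : ∑ e ∈ Ioc 0 Z, (if e.Prime ∧ ¬ IsInert β e ∧ e ≤ y then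
        2 * ((v - u) / c) * (Real.log e / e) + 2 * Real.log e else 0) ≤
        ∑ e ∈ Ioc 0 y with (e.Prime ∧ ¬ IsInert β e),
          (2 * ((v - u) / c) * (Real.log e / e) + 2 * Real.log e) := by
      rw [← sum_filter]
      refine sum_le_sum_of_subset_of_nonneg ?_ ?_
      · intro e he
        simp only [mem_filter, mem_Ioc] at he ⊢
        exact ⟨⟨he.1.1, he.2.2.2⟩, he.2.1, he.2.2.1⟩
      · intro e _ _
        have := Real.log_natCast_nonneg e
        positivity
    refine hsub.trans ?_
    rw [sum_add_distrib, ← mul_sum, ← mul_sum]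
    refine add_le_add (mul_le_mul_of_nonneg_left ?_ (by positivity))
      (mul_le_mul_of_nonneg_left ?_ (by positivity))
    · have h1 := sum_log_div_prime_le hy0
      have h2 : ∑ p ∈ Ioc 0 y with p.Prime, Real.log p / p =
          inertSum β y + ∑ e ∈ Ioc 0 y with (e.Prime ∧ ¬ IsInert β e), Real.log e / e := by
        rw [inertSum, ← filter_filter, ← sum_filter_add_sum_filter_not _ (IsInert β), filter_filter]
        congr 2
        ext p
        rw [mem_filter, mem_filter]
        exact ⟨fun h => ⟨h.1, h.2.2⟩, fun h => ⟨h.1, h.2.1, h.2⟩⟩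
      linarith
    · have h1 := Chebyshev.theta_le_log4_mul_x (Nat.cast_nonneg (α := ℝ) y)
      rw [Chebyshev.theta, Nat.floor_natCast] at h1
      refine le_trans (sum_le_sum_of_subset_of_nonneg ?_ ?_) h1
      · exact fun e he => by
          simp only [mem_filter] at he ⊢
          exact ⟨he.1, he.2.1⟩
      · exact fun e _ _ => Real.log_natCast_nonneg _
  · rw [← sum_filter, ← sum_mul, ← vonMangoldt_sum]
    refine mul_le_mul_of_nonneg_right (sum_le_sum_of_subset_of_nonneg ?_ ?_) (by positivity)
    · intro e he
      rw [Nat.mem_divisors]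
      refine ⟨(mem_filter.1 he).2, ?_⟩
      have := Int.natAbs_pos.2 hβ
      positivity
    · exact fun _ _ _ => vonMangoldt_nonneg
  · rw [← sum_filter, sum_add_distrib, ← mul_sum, ← mul_sum,
      Chebyshev.psi_sub_theta_eq_sum_not_prime, Nat.floor_natCast]
    gcongr

/-! ### The lower bound for the product -/

/-- A nonzero `k ^ 2 + β` is smaller than `k ^ 2` by a factor of at most `1 + |β|`, even where `β` is
negative and `k ^ 2` is close to `-β`. -/
lemma sq_le_natAbs_mul {β : ℤ} {k : ℕ} (h : (k : ℤ) ^ 2 + β ≠ 0) :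
    k ^ 2 ≤ ((k : ℤ) ^ 2 + β).natAbs * (1 + β.natAbs) := by
  have h1 := Int.natAbs_pos.2 h
  by_cases hk : k ^ 2 ≤ 1 + β.natAbs
  · nlinarith
  · have h2 : k ^ 2 ≤ ((k : ℤ) ^ 2 + β).natAbs + β.natAbs := by
      zify
      have := abs_sub ((k : ℤ) ^ 2 + β) β
      rw [add_sub_cancel_right] at this
      exact (le_abs_self _).trans this
    set N := ((k : ℤ) ^ 2 + β).natAbs
    have : 1 * β.natAbs ≤ N * β.natAbs := Nat.mul_le_mul_right _ h1
    rw [mul_add]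
    omega

/-- Lower bound for the logarithm of `∏ (k ^ 2 + β)`. -/
lemma le_sum_log_natAbs {β : ℤ} {I : Finset ℕ} {n : ℕ} (hn : 0 < n)
    (hne : ∀ k : ℕ, (k : ℤ) ^ 2 + β ≠ 0) :
    2 * ((#I - 1) * Real.log n - n) - #I * Real.log (1 + β.natAbs) ≤
      ∑ k ∈ I, Real.log (((k : ℤ) ^ 2 + β).natAbs) := by
  have hlogn : 0 ≤ Real.log n := Real.log_natCast_nonneg _
  have hlogβ : 0 ≤ Real.log (1 + β.natAbs) := Real.log_nonneg (by simp)
  -- `k = 0` is left out, since `log k` is not a lower bound there; it costs one factor.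
  have h1 := card_mul_log_sub_le_sum_log hn (I := I.erase 0)
    fun k hk => Nat.pos_of_ne_zero (mem_erase.1 hk).1
  have hterm : ∀ k ∈ I.erase 0, 2 * Real.log k - Real.log (1 + β.natAbs) ≤
      Real.log (((k : ℤ) ^ 2 + β).natAbs) := by
    intro k hk
    have hk0 : 0 < k := Nat.pos_of_ne_zero (mem_erase.1 hk).1
    have hpos : (0 : ℝ) < (((k : ℤ) ^ 2 + β).natAbs : ℝ) := by
      exact_mod_cast Int.natAbs_pos.2 (hne k)
    rw [sub_le_iff_le_add, ← Real.log_mul hpos.ne' (by positivity)]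
    have : 2 * Real.log k = Real.log ((k : ℝ) ^ 2) := by rw [Real.log_pow]; norm_cast
    rw [this]
    exact Real.log_le_log (by positivity) (by exact_mod_cast sq_le_natAbs_mul (hne k))
  have hcard : (#I : ℝ) - 1 ≤ #(I.erase 0) := by
    rw [sub_le_iff_le_add]
    exact_mod_cast Nat.sub_le_iff_le_add.1 (pred_card_le_card_erase (s := I) (a := 0))
  have hcard' : (#(I.erase 0) : ℝ) ≤ #I := by exact_mod_cast card_erase_le
  calc _ ≤ 2 * (#(I.erase 0) * Real.log n - n) - #(I.erase 0) * Real.log (1 + β.natAbs) := by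
        gcongr
    _ ≤ ∑ k ∈ I.erase 0, (2 * Real.log k - Real.log (1 + β.natAbs)) := by
        rw [sum_sub_distrib, ← mul_sum, sum_const, nsmul_eq_mul]
        gcongr
    _ ≤ ∑ k ∈ I.erase 0, Real.log (((k : ℤ) ^ 2 + β).natAbs) := sum_le_sum hterm
    _ ≤ _ := sum_le_sum_of_subset_of_nonneg (erase_subset _ _)
        fun k _ _ => Real.log_natCast_nonneg _

/-- The index set has at least `(b - a) n / c - O(1)` elements, the `d` being lost because the
progression starts at `d` rather than at `0`. -/
lemma le_card_indexSet {a b : ℚ} {c d n : ℕ} (ha : 0 ≤ a) (hc : 0 < c) :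
    ((b : ℝ) - a) * n / c - d - 1 ≤ #(indexSet a b c d n) := by
  have hc' : (0 : ℚ) < c := by exact_mod_cast hc
  have hc1 : (1 : ℚ) ≤ c := by exact_mod_cast hc
  suffices h : (b - a) * n / c - d - 1 ≤ (#(indexSet a b c d n) : ℚ) by exact_mod_cast h
  set A := a * n / c
  set B := (b * n - d) / c
  have hA : 0 ≤ A := by positivity
  have hd : (d : ℚ) / c ≤ d := div_le_self (Nat.cast_nonneg _) hc1
  have hAB : (b - a) * n / c - d - 1 ≤ B - A - 1 := by
    have : (b - a) * n / c - d / c = B - A := by simp only [A, B]; field_simp; ring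
    linarith
  refine hAB.trans ?_
  have hsub : #(Ico ⌈A⌉₊ (⌊B⌋₊ + 1)) ≤ #(indexSet a b c d n) ∨ B < 0 := by
    by_cases hB : B < 0
    · exact Or.inr hB
    left
    refine card_le_card_of_injOn (fun m => c * m + d) ?_ ?_
    · intro m hm
      have hm : m ∈ Ico ⌈A⌉₊ (⌊B⌋₊ + 1) := hm
      rw [mem_Ico, Nat.ceil_le, Nat.lt_succ_iff, Nat.le_floor_iff (not_lt.1 hB)] at hm
      have h1 := (div_le_iff₀ hc').1 hm.1
      have h2 := (le_div_iff₀ hc').1 hm.2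
      refine mem_coe.2 ((mem_indexSet _ _ _ _ _ _).2 ⟨?_, ?_, m, rfl⟩)
      · push_cast; nlinarith [(Nat.cast_nonneg d : (0 : ℚ) ≤ d)]
      · push_cast; linarith
    · intro m _ m' _ h
      have h : c * m + d = c * m' + d := h
      exact Nat.eq_of_mul_eq_mul_left hc (by omega)
  -- If `B < 0` then the lower bound claimed is negative.
  rcases hsub with h | h
  · rw [Nat.card_Ico] at h
    have h1 : B < ⌊B⌋₊ + 1 := Nat.lt_floor_add_one _
    have h2 : (⌈A⌉₊ : ℚ) < A + 1 := Nat.ceil_lt_add_one hA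
    have h3 : ((⌊B⌋₊ + 1 : ℕ) : ℚ) ≤ #(indexSet a b c d n) + ⌈A⌉₊ := by
      exact_mod_cast Nat.sub_le_iff_le_add.1 h
    push_cast at h3
    linarith
  · have := Nat.cast_nonneg (α := ℚ) #(indexSet a b c d n)
    linarith

/-! ### Comparison of the two bounds -/

lemma one_le_sub_mul_den {a b : ℚ} (hab : a < b) : 1 ≤ (b - a) * (a.den * b.den) := by
  have h1 : (b - a) * (a.den * b.den) = ((b.num * a.den - a.num * b.den : ℤ) : ℚ) := by
    push_cast
    rw [← Rat.mul_den_eq_num a, ← Rat.mul_den_eq_num b]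
    ring
  have h2 : 0 < (b - a) * (a.den * b.den) :=
    mul_pos (sub_pos.2 hab) (by exact_mod_cast Nat.mul_pos a.den_pos b.den_pos)
  rw [h1] at h2 ⊢
  exact_mod_cast h2

lemma le_natAbs_num {b : ℚ} (hb : 0 ≤ b) : b ≤ b.num.natAbs := by
  rw [← Int.cast_natCast, Int.natAbs_of_nonneg (Rat.num_nonneg.2 hb), ← Rat.mul_den_eq_num b]
  exact le_mul_of_one_le_right hb (by exact_mod_cast b.den_pos)

/-- A common upper bound for the integer data of the problem. -/
def height (M : ℕ) (β : ℤ) (a b : ℤ × ℕ) (c d : ℕ) : ℕ :=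
  M + β.natAbs + b.1.natAbs + a.2 + b.2 + c + d + 1

/-- The sum of all error terms in the comparison of the bounds, divided by `n`. -/
lemma polynomial_bound {H M B b₁ c d C₂ C₃ : ℝ} (hH : 1 ≤ H) (hM : M ≤ H) (hB : B ≤ H)
    (hb : b₁ ≤ H) (hc : c ≤ H) (hd : d ≤ H) (hM0 : 0 ≤ M) (hB0 : 0 ≤ B) (hb0 : 0 ≤ b₁)
    (hc0 : 0 ≤ c) (hC₂ : 0 ≤ C₂) (hC₃ : 0 ≤ C₃) :
    2 * b₁ * (M + 2) + 2 * (d + 2) + 2 + (b₁ + 1) * B + 4 * (M + 1) +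
      2 * B * c * (8 * B * b₁ + 2) + (8 * B * b₁ * C₂ + 2 * (C₃ * (b₁ + B))) ≤
      (48 + 8 * C₂ + 4 * C₃) * H ^ 4 := by
  have hH0 : 0 ≤ H := by linarith
  have p1 : H ^ 1 ≤ H ^ 4 := pow_le_pow_right₀ hH (by norm_num)
  have p2 : H ^ 2 ≤ H ^ 4 := pow_le_pow_right₀ hH (by norm_num)
  have p0 : H ^ 0 ≤ H ^ 4 := pow_le_pow_right₀ hH (by norm_num)
  rw [pow_one] at p1
  rw [pow_zero] at p0
  calc _ ≤ 2 * H * (H + 2) + 2 * (H + 2) + 2 + (H + 1) * H + 4 * (H + 1) +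
      2 * H * H * (8 * H * H + 2) + (8 * H * H * C₂ + 2 * (C₃ * (H + H))) := by gcongr
    _ = 16 * H ^ 4 + 7 * H ^ 2 + 11 * H + 10 + 8 * C₂ * H ^ 2 + 4 * C₃ * H := by ring
    _ ≤ 16 * H ^ 4 + 7 * H ^ 4 + 11 * H ^ 4 + 10 * H ^ 4 + 8 * C₂ * H ^ 4 + 4 * C₃ * H ^ 4 := by
        have := mul_le_mul_of_nonneg_left p2 (by positivity : 0 ≤ 8 * C₂)
        have := mul_le_mul_of_nonneg_left p1 (by positivity : 0 ≤ 4 * C₃)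
        linarith
    _ ≤ _ := by nlinarith [pow_nonneg hH0 4]

set_option maxHeartbeats 400000 in
/-- If all prime factors of `F β a b c d n` are at most `M * n`, then the inert sum at `n` is bounded
by an absolute constant times a power of the height of the data. -/
theorem exists_inertSum_le :
    ∃ C : ℝ, ∀ (M : ℕ) (β : ℤ) (a b : ℚ) (c d n : ℕ), (∀ k : ℕ, (k : ℤ) ^ 2 + β ≠ 0) →
      0 ≤ a → a < b → 0 < c → 0 < n →
      (∀ p : ℕ, p.Prime → (p : ℤ) ∣ F β a b c d n → p ≤ M * n) →
      inertSum β n ≤ C * (height M β (ratCode a) (ratCode b) c d : ℝ) ^ 7 := by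
  obtain ⟨C₂, hC₂, hC₂'⟩ := exists_sum_vonMangoldt_div_not_prime_le
  obtain ⟨C₃', hC₃'⟩ := Chebyshev.psi_sub_theta_le_mul_sqrt
  obtain ⟨C₃, hC₃, hC₃0⟩ : ∃ C₃ : ℝ, (∀ x, Chebyshev.psi x - Chebyshev.theta x ≤ C₃ * √x) ∧ 0 ≤ C₃ :=
    ⟨|C₃'|, fun x => (hC₃' x).trans (by gcongr; exact le_abs_self _), abs_nonneg _⟩
  refine ⟨48 + 8 * C₂ + 4 * C₃, fun M β a b c d n hne ha hab hc hn hsmooth => ?_⟩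
  have hβ : β ≠ 0 := by simpa using hne 0
  have hb0 : 0 ≤ b := ha.trans hab.le
  set I := indexSet a b c d n
  set B : ℝ := (β.natAbs : ℝ) with hB
  set b₁ : ℝ := (b.num.natAbs : ℝ) with hb₁
  set H : ℝ := (height M β (ratCode a) (ratCode b) c d : ℝ) with hHdef
  have hHval : H = M + B + b₁ + a.den + b.den + c + d + 1 := by
    rw [hHdef, height]; push_cast; rfl
  have hn' : (1 : ℝ) ≤ n := by exact_mod_cast hn
  have hn0 : (0 : ℝ) < n := by linarith
  have hc' : (1 : ℝ) ≤ c := by exact_mod_cast hc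
  have hM0 : (0 : ℝ) ≤ M := Nat.cast_nonneg _
  have hd0 : (0 : ℝ) ≤ d := Nat.cast_nonneg _
  have hB1 : 1 ≤ B := by
    rw [hB]
    exact_mod_cast Int.natAbs_pos.2 hβ
  have hB0 : 0 ≤ B := zero_le_one.trans hB1
  have hb₁0 : 0 ≤ b₁ := Nat.cast_nonneg _
  have hda : (1 : ℝ) ≤ a.den := by exact_mod_cast a.den_pos
  have hdb : (1 : ℝ) ≤ b.den := by exact_mod_cast b.den_pos
  have hbb : (b : ℝ) ≤ b₁ := by
    have := le_natAbs_num hb0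
    rw [hb₁]
    exact_mod_cast this
  have hab' : (a : ℝ) < b := by exact_mod_cast hab
  have ha' : (0 : ℝ) ≤ a := by exact_mod_cast ha
  have hb' : (0 : ℝ) ≤ b := by exact_mod_cast hb0
  have hI : ∀ k ∈ I, (a * n : ℝ) ≤ k ∧ (k : ℝ) ≤ b * n := by
    intro k hk
    obtain ⟨h1, h2, -⟩ := (mem_indexSet _ _ _ _ _ _).1 hk
    exact ⟨by exact_mod_cast h1, by exact_mod_cast h2⟩
  have hmod : ∀ k ∈ I, ∀ l ∈ I, k ≡ l [MOD c] := by
    intro k hk l hl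
    obtain ⟨-, -, m, rfl⟩ := (mem_indexSet _ _ _ _ _ _).1 hk
    obtain ⟨-, -, m', rfl⟩ := (mem_indexSet _ _ _ _ _ _).1 hl
    simp [Nat.ModEq]
  have hu : (0 : ℝ) ≤ a * n := by positivity
  have huv : (a * n : ℝ) ≤ b * n := by gcongr
  have hvb : (b * n : ℝ) ≤ b₁ * n := by gcongr
  -- The number of indices is `L + O(1)`.
  set L : ℝ := (b * n - a * n) / c with hL
  have hLle : L ≤ b₁ * n := by
    refine (div_le_self (by linarith) hc').trans ?_
    linarith
  have hL0 : 0 ≤ L := div_nonneg (by linarith) (by linarith)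
  have hLge : n ≤ L * H ^ 3 := by
    have h1 : (1 : ℝ) ≤ (b - a) * (a.den * b.den) := by exact_mod_cast one_le_sub_mul_den hab
    have h2 : (a.den : ℝ) * b.den * c ≤ H ^ 3 := by
      have : (a.den : ℝ) * b.den * c ≤ H * H * H := by
        gcongr <;> linarith
      linarith [this, (by ring : H * H * H = H ^ 3)]
    have h3 : L * ((a.den : ℝ) * b.den * c) = ((b - a) * (a.den * b.den)) * n := by
      rw [hL]; field_simp
    calc (n : ℝ) ≤ ((b - a) * (a.den * b.den)) * n := le_mul_of_one_le_left hn0.le h1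
      _ = L * ((a.den : ℝ) * b.den * c) := h3.symm
      _ ≤ _ := mul_le_mul_of_nonneg_left h2 hL0
  -- The two bounds for the logarithm of the product, with `y = (M + 1) n`, which is positive even
  -- for `M = 0`.
  have hlow := le_sum_log_natAbs (I := I) hn hne
  set Z : ℕ := (b.num.natAbs * n) ^ 2 + β.natAbs with hZdef
  have hZ : ∀ k ∈ I, ((k : ℤ) ^ 2 + β).natAbs ≤ Z := by
    intro k hk
    have h1 : k ≤ b.num.natAbs * n := by
      have := (hI k hk).2.trans hvb
      rw [hb₁] at this
      exact_mod_cast this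
    refine (Int.natAbs_add_le _ _).trans (Nat.add_le_add_right ?_ _)
    rw [Int.natAbs_pow, Int.natAbs_natCast]
    exact Nat.pow_le_pow_left h1 2
  have hy : ∀ k ∈ I, ∀ p : ℕ, p.Prime → (p : ℤ) ∣ (k : ℤ) ^ 2 + β → p ≤ (M + 1) * n := by
    intro k hk p hp hpk
    exact (hsmooth p hp (hpk.trans (dvd_prod_of_mem (fun k : ℕ => (k : ℤ) ^ 2 + β) hk))).trans
      (Nat.mul_le_mul_right _ (Nat.le_succ _))
  have hup := sum_log_natAbs_le hβ hc hu huv (y := (M + 1) * n) (by positivity) hI hmod hy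
    (fun k _ => hne k) hZ (hC₂' Z)
  rw [← hL] at hup
  -- Each term of the two bounds is estimated by a multiple of `n`, up to `2 L log n`.
  have hcardge : L - d - 1 ≤ #I := by
    refine le_trans (le_of_eq ?_) (le_card_indexSet (b := b) (d := d) (n := n) ha hc)
    rw [hL]; ring
  have hcardle : (#I : ℝ) ≤ b₁ * n + 1 := by
    have := card_le_of_modEq one_pos huv hI fun k _ l _ => Nat.modEq_one
    rw [Nat.cast_one, div_one] at this
    linarith
  have hlog0 : 0 ≤ Real.log n := Real.log_natCast_nonneg _
  have hlogn : Real.log n ≤ n := (Real.log_le_sub_one_of_pos hn0).trans (by linarith)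
  have hlog4 : Real.log 4 ≤ 2 := by
    rw [show (4 : ℝ) = 2 ^ 2 by norm_num, Real.log_pow]
    have := Real.log_two_lt_d9
    push_cast
    linarith
  have hlogB : Real.log (1 + B) ≤ B := by
    have := Real.log_le_sub_one_of_pos (by positivity : 0 < 1 + B)
    linarith
  have hlogy : Real.log (((M + 1) * n : ℕ) : ℝ) ≤ M + Real.log n := by
    push_cast
    rw [Real.log_mul (by positivity) (by positivity)]
    have := Real.log_le_sub_one_of_pos (by positivity : (0 : ℝ) < M + 1)
    linarith
  have hlogm : Real.log ((2 * β.natAbs * c : ℕ) : ℝ) ≤ 2 * B * c := by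
    push_cast
    have := Real.log_le_sub_one_of_pos (by positivity : (0 : ℝ) < 2 * B * c)
    linarith
  have hmono : inertSum β n ≤ inertSum β ((M + 1) * n) :=
    inertSum_mono β (Nat.le_mul_of_pos_left _ (Nat.succ_pos _))
  have hψ : Chebyshev.psi Z - Chebyshev.theta Z ≤ C₃ * ((b₁ + B) * n) := by
    refine (hC₃ Z).trans (mul_le_mul_of_nonneg_left ?_ hC₃0)
    rw [Real.sqrt_le_left (by positivity), hZdef]
    push_cast
    rw [← hB, ← hb₁]
    have h1 : B ≤ B ^ 2 := le_self_pow₀ hB1 two_ne_zero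
    have h2 : B ^ 2 ≤ B ^ 2 * (n : ℝ) ^ 2 :=
      le_mul_of_one_le_right (by positivity) (one_le_pow₀ hn')
    have h3 : 0 ≤ b₁ * B * (n : ℝ) ^ 2 := by positivity
    have h4 : ((b₁ + B) * n) ^ 2 = (b₁ * n) ^ 2 + B ^ 2 * (n : ℝ) ^ 2 + 2 * (b₁ * B * (n : ℝ) ^ 2) := by
      ring
    linarith
  have e1 : (L - d - 2) * Real.log n ≤ (#I - 1) * Real.log n :=
    mul_le_mul_of_nonneg_right (by linarith) hlog0
  have e2 : (d + 2) * Real.log n ≤ (d + 2) * n := by gcongr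
  have e3 : #I * Real.log (1 + B) ≤ (b₁ * n + 1) * B :=
    mul_le_mul hcardle hlogB (Real.log_nonneg (by linarith)) (by positivity)
  have e4 : L * (Real.log (((M + 1) * n : ℕ) : ℝ) + Real.log 4 - inertSum β ((M + 1) * n)) ≤
      L * (M + Real.log n + 2 - inertSum β n) := by gcongr
  have e5 : L * (M + 2) ≤ b₁ * n * (M + 2) := by gcongr
  have e6 : Real.log 4 * (((M + 1) * n : ℕ) : ℝ) ≤ 2 * ((M + 1) * n) := by
    push_cast
    gcongr
  have e7 : Real.log ((2 * β.natAbs * c : ℕ) : ℝ) * (8 * B * (b * n) + 2) ≤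
      2 * B * c * (8 * B * (b₁ * n) + 2) := by
    gcongr
  have e8 : 8 * B * (b * n) * C₂ ≤ 8 * B * (b₁ * n) * C₂ := by gcongr
  have e9 : B * 1 ≤ B * n := by gcongr
  have e10 : 2 * B * c * 2 * 1 ≤ 2 * B * c * 2 * n := by gcongr
  -- The terms `2 L log n` cancel, which leaves the inert sum against `O(n)`.
  have hkey : 2 * (L * inertSum β n) ≤ n * (2 * b₁ * (M + 2) + 2 * (d + 2) + 2 + (b₁ + 1) * B +
      4 * (M + 1) + 2 * B * c * (8 * B * b₁ + 2) + (8 * B * b₁ * C₂ + 2 * (C₃ * (b₁ + B)))) := by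
    linarith
  have hH1 : 1 ≤ H := by linarith
  have hpoly := polynomial_bound (H := H) (M := M) (B := B) (b₁ := b₁) (c := c) (d := d) hH1
    (by linarith) (by linarith) (by linarith) (by linarith) (by linarith) hM0 hB0 hb₁0
    (by linarith) hC₂ hC₃0
  set K := 48 + 8 * C₂ + 4 * C₃
  have hT0 : 0 ≤ inertSum β n := by
    refine sum_nonneg fun p _ => div_nonneg (Real.log_natCast_nonneg _) (Nat.cast_nonneg _)
  have hfin : L * inertSum β n ≤ L * (K * H ^ 7) := by
    have h1 : n * (K * H ^ 4) ≤ L * H ^ 3 * (K * H ^ 4) := by gcongr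
    have h2 := mul_le_mul_of_nonneg_left hpoly hn0.le
    have h3 : L * H ^ 3 * (K * H ^ 4) = L * (K * H ^ 7) := by ring
    have h4 : 0 ≤ L * inertSum β n := by positivity
    linarith
  have hLpos : 0 < L := div_pos (sub_pos.2 (mul_lt_mul_of_pos_right hab' hn0)) (by linarith)
  exact le_of_mul_le_mul_left hfin hLpos

/-! ### Divergence over the inert primes -/

lemma jacobiSym_mul_sq {s m : ℤ} {a : ℕ} (h : m.gcd a = 1) : J(s * m ^ 2 | a) = J(s | a) := by
  rw [jacobiSym.mul_left, jacobiSym.sq_one' h, mul_one]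

/-- Simultaneous congruences modulo coprime `Q` and `W`, solved by an `a` prime to `4 N`. -/
lemma exists_modEq_and_coprime {Q N r W : ℕ} (hQ : Q.Coprime W) (hr : r.Coprime Q)
    (hN : ∃ k, 4 * N ∣ Q ^ k * W) :
    ∃ a : ℕ, a ≡ r [MOD Q] ∧ a ≡ 1 [MOD W] ∧ a.Coprime (4 * N) := by
  obtain ⟨a, h1, h2⟩ := Nat.chineseRemainder hQ r 1
  obtain ⟨k, hk⟩ := hN
  refine ⟨a, h1, h2, Nat.Coprime.coprime_dvd_right hk (Nat.Coprime.mul_right ?_ ?_)⟩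
  · exact Nat.Coprime.pow_right _ (h1.gcd_eq.trans hr)
  · exact h2.gcd_eq.trans (Nat.gcd_one_left _)

/-- A non-square integer has a residue class modulo `4 |D|` on which its Jacobi symbol
is `-1`. -/
lemma exists_jacobiSym_eq_neg_one {D : ℤ} (hD : ¬ IsSquare D) :
    ∃ a : ℕ, a.Coprime (4 * D.natAbs) ∧ J(D | a) = -1 := by
  have hD0 : D ≠ 0 := by rintro rfl; exact hD ⟨0, rfl⟩
  have hN0 : D.natAbs ≠ 0 := Int.natAbs_ne_zero.2 hD0
  obtain ⟨s₀, m, hms, hsq⟩ := Nat.sq_mul_squarefree D.natAbs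
  obtain ⟨ε, hε, hDε⟩ : ∃ ε : ℤ, (ε = 1 ∨ ε = -1) ∧ D = ε * s₀ * (m : ℤ) ^ 2 := by
    have : (D.natAbs : ℤ) = (m : ℤ) ^ 2 * s₀ := by exact_mod_cast hms.symm
    rcases Int.natAbs_eq D with h | h
    · exact ⟨1, Or.inl rfl, by rw [h, this]; ring⟩
    · exact ⟨-1, Or.inr rfl, by rw [h, this]; ring⟩
  have hred : ∀ a : ℕ, a.Coprime (4 * D.natAbs) → J(D | a) = J(ε * s₀ | a) := by
    intro a ha
    rw [hDε]
    refine jacobiSym_mul_sq ?_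
    rw [Int.gcd_natCast_natCast]
    exact (Nat.Coprime.coprime_dvd_right ⟨4 * (m * s₀), by rw [← hms]; ring⟩ ha).symm
  -- `a` is prescribed modulo one prime (or modulo `8`) that decides the sign, and is `1` modulo the
  -- rest of `8 |D|`, so that the other factors have Jacobi symbol `1`.
  by_cases hq : ∃ q : ℕ, q.Prime ∧ q ≠ 2 ∧ q ∣ s₀
  · obtain ⟨q, hqp, hq2, t, rfl⟩ := hq
    have hqF : Fact q.Prime := ⟨hqp⟩
    have hqodd : Odd q := hqp.odd_of_ne_two hq2
    have hqt : q.Coprime t := (Nat.squarefree_mul_iff.1 hsq).1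
    obtain ⟨r, hr⟩ := FiniteField.exists_nonsquare (F := ZMod q) (by rwa [ZMod.ringChar_zmod_n])
    have hrc : r.val.Coprime q := by
      rw [Nat.coprime_comm, hqp.coprime_iff_not_dvd, ← ZMod.natCast_eq_zero_iff, ZMod.natCast_zmod_val]
      rintro rfl
      exact hr ⟨0, by simp⟩
    have hW : q.Coprime (8 * (ordCompl[q] D.natAbs)) := by
      refine Nat.Coprime.mul_right ?_ (Nat.coprime_ordCompl hqp hN0)
      exact Nat.Coprime.pow_right 3 (Nat.coprime_two_right.2 hqodd)
    have hord := Nat.ordProj_mul_ordCompl_eq_self D.natAbs q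
    obtain ⟨a, ha1, ha2, ha3⟩ := exists_modEq_and_coprime (N := D.natAbs) hW hrc
      ⟨D.natAbs.factorization q, 2, by rw [mul_left_comm, hord]; ring⟩
    refine ⟨a, ha3, ?_⟩
    have ha8 : a ≡ 1 [MOD 8] := ha2.of_dvd ⟨_, rfl⟩
    have ha4 : a % 4 = 1 := ha8.of_dvd (by norm_num : 4 ∣ 8)
    have haodd : Odd a := Nat.odd_iff.2 (by omega)
    have htd : t ∣ ordCompl[q] D.natAbs := by
      have : t ∣ ordProj[q] D.natAbs * ordCompl[q] D.natAbs := by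
        rw [hord, ← hms]; exact ⟨m ^ 2 * q, by ring⟩
      exact (Nat.Coprime.pow_right _ hqt.symm).dvd_of_dvd_mul_left this
    have ht0 : 0 < t := Nat.pos_of_ne_zero (by rintro rfl; simp at hsq)
    have hεt : (ε * t).natAbs = t := by rcases hε with rfl | rfl <;> simp
    have hJ1 : J(ε * t | a) = 1 := by
      rw [jacobiSym.mod_right _ haodd, hεt]
      have : a ≡ 1 [MOD 4 * t] := ha2.of_dvd (Nat.mul_dvd_mul (by norm_num) htd)
      rw [this, Nat.mod_eq_of_lt (by omega), jacobiSym.one_right]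
    have hJ2 : J(q | a) = -1 := by
      rw [jacobiSym.quadratic_reciprocity_one_mod_four' hqodd ha4,
        ZMod.nonsquare_iff_jacobiSym_eq_neg_one, Int.cast_natCast,
        (ZMod.natCast_eq_natCast_iff _ _ _).2 ha1, ZMod.natCast_zmod_val]
      exact hr
    rw [hred a ha3, show ε * ((q * t : ℕ) : ℤ) = (ε * t) * q by push_cast; ring,
      jacobiSym.mul_left, hJ1, hJ2, one_mul]
  · push Not at hq
    have hs : s₀ = 1 ∨ s₀ = 2 := by
      by_cases h2 : 2 ∣ s₀
      · obtain ⟨k, rfl⟩ := h2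
        right
        have h2k : Nat.Coprime 2 k := (Nat.squarefree_mul_iff.1 hsq).1
        by_contra hk
        obtain ⟨q, hqp, hqk⟩ := Nat.exists_prime_and_dvd (n := k) (by rintro rfl; simp at hk)
        refine hq q hqp ?_ (hqk.mul_left 2)
        rintro rfl
        exact (Nat.Prime.coprime_iff_not_dvd Nat.prime_two).1 h2k hqk
      · left
        by_contra hk
        obtain ⟨q, hqp, hqk⟩ := Nat.exists_prime_and_dvd hk
        exact hq q hqp (by rintro rfl; exact h2 hqk) hqk
    have hs1 : ε * (s₀ : ℤ) ≠ 1 := by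
      intro h
      apply hD
      rw [hDε, h]
      exact ⟨m, by ring⟩
    have hord := Nat.ordProj_mul_ordCompl_eq_self D.natAbs 2
    have hW : Nat.Coprime 8 (ordCompl[2] D.natAbs) :=
      Nat.Coprime.pow_left 3 (Nat.coprime_ordCompl Nat.prime_two hN0)
    have hdiv : ∃ k, 4 * D.natAbs ∣ 8 ^ k * ordCompl[2] D.natAbs := by
      refine ⟨1 + D.natAbs.factorization 2, 2 * 4 ^ (D.natAbs.factorization 2), ?_⟩
      have h8 : 8 ^ D.natAbs.factorization 2 =
          4 ^ D.natAbs.factorization 2 * 2 ^ D.natAbs.factorization 2 := by rw [← mul_pow]; norm_num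
      rw [pow_add, h8, mul_assoc, mul_assoc, hord]
      ring
    have key : ∀ r : ℕ, r.Coprime 8 → ∃ a : ℕ, a % 8 = r % 8 ∧ a.Coprime (4 * D.natAbs) := by
      intro r hr
      obtain ⟨a, h1, -, h3⟩ := exists_modEq_and_coprime hW hr hdiv
      exact ⟨a, h1, h3⟩
    rcases hs with rfl | rfl <;> rcases hε with rfl | rfl
    · simp at hs1
    · obtain ⟨a, h1, h2⟩ := key 3 (by norm_num)
      refine ⟨a, h2, ?_⟩
      rw [hred a h2, Nat.cast_one, mul_one, jacobiSym.at_neg_one (Nat.odd_iff.2 (by omega)),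
        ZMod.χ₄_nat_three_mod_four (by omega)]
    · obtain ⟨a, h1, h2⟩ := key 5 (by norm_num)
      refine ⟨a, h2, ?_⟩
      rw [hred a h2, one_mul, Nat.cast_ofNat, jacobiSym.at_two (Nat.odd_iff.2 (by omega)),
        ZMod.χ₈_nat_eq_if_mod_eight]
      rw [if_neg (by omega), if_neg (by omega)]
    · obtain ⟨a, h1, h2⟩ := key 5 (by norm_num)
      refine ⟨a, h2, ?_⟩
      rw [hred a h2, Nat.cast_ofNat, neg_one_mul, jacobiSym.at_neg_two (Nat.odd_iff.2 (by omega)),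
        ZMod.χ₈'_nat_eq_if_mod_eight]
      rw [if_neg (by omega), if_neg (by omega)]

lemma isInert_of_jacobiSym {β : ℤ} {p : ℕ} (hp : p.Prime) (h : J(-β | p) = -1) : IsInert β p := by
  refine ⟨hp, fun x _ hx => ?_⟩
  have : Fact p.Prime := ⟨hp⟩
  have h1 := (jacobiSym.prime_dvd_of_eq_neg_one h (x := x) (y := 1) (by convert! hx using 1; ring)).2
  exact hp.one_lt.ne' (by exact_mod_cast Int.eq_one_of_dvd_one (by positivity) h1)

/-- Dirichlet's theorem for a residue class of inert primes makes `∑ log p / p` over the inert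
primes diverge. -/
theorem tendsto_inertSum {β : ℤ} (hβ : ¬ IsSquare (-β)) :
    Filter.Tendsto (inertSum β) Filter.atTop Filter.atTop := by
  classical
  obtain ⟨a, ha, hJ⟩ := exists_jacobiSym_eq_neg_one hβ
  have hβ0 : β ≠ 0 := by rintro rfl; exact hβ ⟨0, rfl⟩
  set q := 4 * (-β).natAbs with hq
  have : NeZero q := ⟨by simpa [hq] using hβ0⟩
  have hunit : IsUnit (a : ZMod q) := (ZMod.isUnit_iff_coprime a q).2 ha
  have haodd : a % 2 = 1 :=
    Nat.odd_iff.1 (Nat.coprime_two_right.1 (ha.coprime_dvd_right ⟨2 * (-β).natAbs, by ring⟩))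
  have hdiv := vonMangoldt.not_summable_residueClass_prime_div hunit
  have hnn : ∀ n : ℕ,
      0 ≤ (if n.Prime then vonMangoldt.residueClass (a : ZMod q) n else 0) / n := by
    intro n
    positivity [vonMangoldt.residueClass_nonneg (a : ZMod q) n]
  rw [not_summable_iff_tendsto_nat_atTop_of_nonneg hnn] at hdiv
  refine Filter.tendsto_atTop_mono (fun n => ?_) hdiv
  have hlog : ∀ p : ℕ, 0 ≤ Real.log p / p := fun p =>
    div_nonneg (Real.log_natCast_nonneg _) (Nat.cast_nonneg _)
  refine (sum_le_sum (g := fun p : ℕ => if IsInert β p then Real.log p / p else 0) ?_).trans ?_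
  · intro p _
    by_cases hp : p.Prime
    · by_cases hpa : (p : ZMod q) = a
      · have hpa' : p % q = a % q := (ZMod.natCast_eq_natCast_iff _ _ _).1 hpa
        have hpodd : Odd p := by
          have : p ≡ a [MOD 2] := Nat.ModEq.of_dvd ⟨2 * (-β).natAbs, by rw [hq]; ring⟩ hpa'
          exact Nat.odd_iff.2 (Eq.trans this haodd)
        have hin : IsInert β p := by
          refine isInert_of_jacobiSym hp ?_
          rw [jacobiSym.mod_right _ hpodd, hpa', ← jacobiSym.mod_right _ (Nat.odd_iff.2 haodd), hJ]
        rw [if_pos hp, if_pos hin, vonMangoldt.residueClass, Set.indicator_of_mem (by exact hpa),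
          vonMangoldt_apply_prime hp]
      · rw [if_pos hp, vonMangoldt.residueClass, Set.indicator_of_notMem (by exact hpa), zero_div]
        split_ifs
        exacts [hlog p, le_rfl]
    · have : ¬ IsInert β p := fun h => hp h.1
      simp [hp, this]
  · rw [← sum_filter, inertSum]
    refine sum_le_sum_of_subset_of_nonneg (fun p hp => ?_) fun p _ _ => hlog p
    rw [mem_filter, mem_range] at hp
    exact mem_filter.2 ⟨mem_Ioc.2 ⟨hp.2.1.pos, hp.1.le⟩, hp.2⟩

/-! ### The computable bound -/

/-- The weight of `p` in the integer approximation to `inertSum`: the binary logarithm of `p`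
if `p` is inert, and `0` otherwise. -/
noncomputable def inertWeight (β : ℤ) (p : ℕ) : ℕ :=
  open Classical in if IsInert β p then Nat.findGreatest (fun k => 2 ^ k ≤ p) p else 0

/-- The sum of `⌊s / p⌋ log₂ p` over the inert primes `p < N`, an integer approximation to
`s * inertSum β N`. -/
noncomputable def scaledInertSum (β : ℤ) (s N : ℕ) : ℕ :=
  ∑ p ∈ range N, s / p * inertWeight β p

lemma primrec_natAbs : Primrec Int.natAbs := by
  have h : Primrec fun n : ℤ => (Encodable.encode n + 1) / 2 :=
    Primrec.nat_div.comp (Primrec.succ.comp Primrec.encode) (Primrec.const 2)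
  refine h.of_eq fun n => ?_
  cases n with
  | ofNat n =>
    -- Integers are encoded by interleaving `0, 1, …` with `-1, -2, …`.
    have : Encodable.encode (Int.ofNat n) = 2 * n := rfl
    rw [this, Int.ofNat_eq_natCast, Int.natAbs_natCast]; omega
  | negSucc n =>
    have : Encodable.encode (Int.negSucc n) = 2 * n + 1 := rfl
    rw [this, Int.natAbs_negSucc]; omega

lemma primrecPred_nonneg : PrimrecPred fun n : ℤ => 0 ≤ n := by
  have h : PrimrecPred fun n : ℤ => Encodable.encode n % 2 = 0 :=
    Primrec.eq.comp (Primrec.nat_mod.comp Primrec.encode (Primrec.const 2)) (Primrec.const 0)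
  refine h.of_eq fun n => ?_
  cases n with
  | ofNat n =>
    have : Encodable.encode (Int.ofNat n) = 2 * n := rfl
    rw [this]; simp
  | negSucc n =>
    have : Encodable.encode (Int.negSucc n) = 2 * n + 1 := rfl
    rw [this]; simp

/-- Divisibility of `x ^ 2 + β` in terms of natural numbers, as needed for primitive recursion. -/
lemma dvd_sq_add_iff {β : ℤ} {p x : ℕ} : (p : ℤ) ∣ (x : ℤ) ^ 2 + β ↔
    (0 ≤ β ∧ (x * x + β.natAbs) % p = 0) ∨ (¬ 0 ≤ β ∧ x * x % p = β.natAbs % p) := by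
  by_cases h : 0 ≤ β
  · obtain ⟨b, rfl⟩ := Int.eq_ofNat_of_zero_le h
    simp only [Int.natAbs_natCast, Nat.cast_nonneg, true_and, not_true_eq_false, false_and, or_false]
    rw [← Nat.dvd_iff_mod_eq_zero, ← Int.natCast_dvd_natCast, ← pow_two]
    push_cast
    rfl
  · obtain ⟨b, rfl⟩ := Int.exists_eq_neg_ofNat (le_of_not_ge h)
    simp only [h, false_and, not_false_eq_true, true_and, false_or, Int.natAbs_neg, Int.natAbs_natCast]
    rw [← sub_eq_add_neg, ← pow_two]
    have : (x ^ 2 % p = b % p) ↔ (x ^ 2 ≡ b [MOD p]) := Iff.rfl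
    rw [this, Nat.ModEq.comm, Nat.modEq_iff_dvd]
    push_cast
    rfl

lemma primrecPred_isInert : PrimrecPred fun q : ℤ × ℕ => IsInert q.1 q.2 := by
  have hdvd : PrimrecRel fun m p : ℕ => p % m = 0 :=
    Primrec.eq.comp (Primrec.nat_mod.comp Primrec.snd Primrec.fst) (Primrec.const 0)
  have hprime : PrimrecPred fun p : ℕ => p.Prime := by
    have h1 : PrimrecRel fun m p : ℕ => ¬ p % m = 0 ∨ m = 1 :=
      PrimrecPred.or hdvd.not (Primrec.eq.comp Primrec.fst (Primrec.const 1))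
    have h2 : PrimrecPred fun p : ℕ => ∀ m < p, ¬ p % m = 0 ∨ m = 1 :=
      h1.forall_lt.comp Primrec.id Primrec.id
    refine ((Primrec.nat_le.comp (Primrec.const 2) Primrec.id).and h2).of_eq fun p => ?_
    rw [Nat.prime_def_lt]
    simp only [Nat.dvd_iff_mod_eq_zero, imp_iff_not_or]
    rfl
  have hroot : PrimrecRel fun (x : ℕ) (q : ℤ × ℕ) => ¬ (q.2 : ℤ) ∣ (x : ℤ) ^ 2 + q.1 := by
    have hβ : Primrec fun z : ℕ × ℤ × ℕ => z.2.1 := Primrec.fst.comp Primrec.snd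
    have hp : Primrec fun z : ℕ × ℤ × ℕ => z.2.2 := Primrec.snd.comp Primrec.snd
    have hx2 : Primrec fun z : ℕ × ℤ × ℕ => z.1 * z.1 := Primrec.nat_mul.comp Primrec.fst Primrec.fst
    have habs := primrec_natAbs.comp hβ
    have hsgn := primrecPred_nonneg.comp hβ
    have h1 := Primrec.eq.comp (Primrec.nat_mod.comp (Primrec.nat_add.comp hx2 habs) hp)
      (Primrec.const 0)
    have h2 := Primrec.eq.comp (Primrec.nat_mod.comp hx2 hp) (Primrec.nat_mod.comp habs hp)
    exact (((hsgn.and h1).or (hsgn.not.and h2)).of_eq fun z => dvd_sq_add_iff.symm).not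
  have hall : PrimrecPred fun q : ℤ × ℕ =>
      ∀ x ∈ List.range q.2, ¬ (q.2 : ℤ) ∣ (x : ℤ) ^ 2 + q.1 :=
    hroot.forall_mem_list.comp (Primrec.list_range.comp Primrec.snd) Primrec.id
  refine ((hprime.comp Primrec.snd).and hall).of_eq fun q => ?_
  simp [IsInert]

lemma primrec_inertWeight : Primrec₂ inertWeight := by
  classical
  have hpow : Primrec₂ ((· ^ ·) : ℕ → ℕ → ℕ) := Primrec₂.unpaired'.1 Nat.Primrec.pow
  have hlog : Primrec fun q : ℤ × ℕ => Nat.findGreatest (fun k => 2 ^ k ≤ q.2) q.2 :=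
    Primrec.nat_findGreatest Primrec.snd
      (Primrec.nat_le.comp (hpow.comp (Primrec.const 2) Primrec.snd) (Primrec.snd.comp Primrec.fst))
  exact (Primrec.ite primrecPred_isInert hlog (Primrec.const 0)).of_eq fun q => by
    simp [inertWeight]

lemma primrec_scaledInertSum :
    Primrec₂ fun (q : ℤ × ℕ) (N : ℕ) => scaledInertSum q.1 q.2 N := by
  have hstep : Primrec₂ fun (q : ℤ × ℕ) (z : ℕ × ℕ) => z.2 + q.2 / z.1 * inertWeight q.1 z.1 := by
    have hp : Primrec fun w : (ℤ × ℕ) × ℕ × ℕ => w.2.1 := Primrec.fst.comp Primrec.snd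
    have hS : Primrec fun w : (ℤ × ℕ) × ℕ × ℕ => w.2.2 := Primrec.snd.comp Primrec.snd
    have hβ : Primrec fun w : (ℤ × ℕ) × ℕ × ℕ => w.1.1 := Primrec.fst.comp Primrec.fst
    have hs : Primrec fun w : (ℤ × ℕ) × ℕ × ℕ => w.1.2 := Primrec.snd.comp Primrec.fst
    exact Primrec.nat_add.comp hS
      (Primrec.nat_mul.comp (Primrec.nat_div.comp hs hp) (primrec_inertWeight.comp hβ hp))
  refine (Primrec.nat_rec (Primrec.const (0 : ℕ)) hstep).of_eq fun q N => ?_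
  induction N with
  | zero => rfl
  | succ N ih =>
    simp only at ih ⊢
    rw [ih, scaledInertSum, scaledInertSum, sum_range_succ]

lemma primrec_height : Primrec fun z : ℕ × ℤ × (ℤ × ℕ) × (ℤ × ℕ) × ℕ × ℕ =>
    height z.1 z.2.1 z.2.2.1 z.2.2.2.1 z.2.2.2.2.1 z.2.2.2.2.2 := by
  have t1 : Primrec fun z : ℕ × ℤ × (ℤ × ℕ) × (ℤ × ℕ) × ℕ × ℕ => z.2 := Primrec.snd
  have t2 := Primrec.snd.comp t1
  have t3 := Primrec.snd.comp t2
  have t4 := Primrec.snd.comp t3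
  exact Primrec.succ.comp <| Primrec.nat_add.comp (Primrec.nat_add.comp (Primrec.nat_add.comp
    (Primrec.nat_add.comp (Primrec.nat_add.comp (Primrec.nat_add.comp Primrec.fst
      (primrec_natAbs.comp (Primrec.fst.comp t1)))
      (primrec_natAbs.comp (Primrec.fst.comp (Primrec.fst.comp t3))))
      (Primrec.snd.comp (Primrec.fst.comp t2))) (Primrec.snd.comp (Primrec.fst.comp t3)))
      (Primrec.fst.comp t4)) (Primrec.snd.comp t4)

lemma primrecPred_isSquare_neg : PrimrecPred fun β : ℤ => IsSquare (-β) := by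
  have hsqrt := Primrec.nat_sqrt.comp primrec_natAbs
  refine (((Primrec.eq.comp Primrec.id (Primrec.const 0)).or primrecPred_nonneg.not).and
    (Primrec.eq.comp (Primrec.nat_mul.comp hsqrt hsqrt) primrec_natAbs)).of_eq fun β => ?_
  simp only [id]
  constructor
  · rintro ⟨h, h2⟩
    have hle : β ≤ 0 := by omega
    refine ⟨(Nat.sqrt β.natAbs : ℤ), ?_⟩
    rw [← Nat.cast_mul, h2]
    omega
  · rintro ⟨r, hr⟩
    have h0 : 0 ≤ r * r := mul_self_nonneg r
    refine ⟨by omega, ?_⟩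
    have : β.natAbs = r.natAbs * r.natAbs := by
      rw [← Int.natAbs_mul, ← hr, Int.natAbs_neg]
    rw [this, Nat.sqrt_eq]

/-- Unbounded search for a witness of a decidable relation is computable when it always
succeeds. -/
lemma _root_.PrimrecRel.computable_find {α : Type*} [Primcodable α] {P : α → ℕ → Prop}
    [∀ a, DecidablePred (P a)] (hP : PrimrecRel P) (h : ∀ a, ∃ n, P a n) :
    Computable fun a => Nat.find (h a) := by
  have h1 : Partrec₂ fun (a : α) (n : ℕ) => (Part.some (decide (P a n)) : Part Bool) :=
    (Primrec₂.to_comp hP.decide).partrec₂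
  refine (Partrec.rfind h1).of_eq fun a => Part.eq_some_iff.2 ?_
  refine Nat.mem_rfind.2 ⟨?_, fun {m} hm => ?_⟩
  · simpa using Nat.find_spec (h a)
  · simpa using Nat.find_min (h a) hm

lemma inertWeight_le {β : ℤ} {p : ℕ} (h : IsInert β p) :
    (inertWeight β p : ℝ) ≤ 2 * Real.log p := by
  rw [inertWeight, if_pos h]
  set k := Nat.findGreatest (fun k => 2 ^ k ≤ p) p
  have hk : 2 ^ k ≤ p :=
    Nat.findGreatest_spec (P := fun k => 2 ^ k ≤ p) (Nat.zero_le _) (by simpa using h.1.one_le)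
  have h1 : Real.log ((2 : ℝ) ^ k) ≤ Real.log p :=
    Real.log_le_log (by positivity) (by exact_mod_cast hk)
  rw [Real.log_pow] at h1
  have h2 := Real.log_two_gt_d9
  have h3 : (0 : ℝ) ≤ k := Nat.cast_nonneg _
  nlinarith

lemma log_le_inertWeight {β : ℤ} {p : ℕ} (h : IsInert β p) :
    Real.log p ≤ 2 * inertWeight β p := by
  rw [inertWeight, if_pos h]
  set k := Nat.findGreatest (fun k => 2 ^ k ≤ p) p
  have hk : p < 2 ^ (k + 1) := by
    by_contra! hc
    have : k + 1 ≤ p := (Nat.lt_two_pow_self).le.trans hc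
    exact Nat.findGreatest_is_greatest (P := fun k => 2 ^ k ≤ p) (Nat.lt_succ_self k) this hc
  have hk1 : 1 ≤ k := Nat.le_findGreatest h.1.one_le (by simpa using h.1.two_le)
  have h1 : Real.log p ≤ Real.log ((2 : ℝ) ^ (k + 1)) :=
    Real.log_le_log (by exact_mod_cast h.1.pos) (by exact_mod_cast hk.le)
  rw [Real.log_pow] at h1
  have h2 := Real.log_two_lt_d9
  have h3 : (1 : ℝ) ≤ k := by exact_mod_cast hk1
  push_cast at h1
  nlinarith

lemma inertWeight_le_self (β : ℤ) (p : ℕ) : inertWeight β p ≤ p := by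
  rw [inertWeight]
  split_ifs
  · exact Nat.findGreatest_le _
  · exact Nat.zero_le _

/-- Soundness of the integer approximation. -/
lemma scaledInertSum_le (β : ℤ) (s N : ℕ) :
    (scaledInertSum β s N : ℝ) ≤ 2 * s * inertSum β N := by
  classical
  rw [scaledInertSum, inertSum, mul_sum]
  push_cast
  refine (sum_le_sum (g := fun p : ℕ => if IsInert β p then 2 * s * (Real.log p / p) else 0)
    fun p _ => ?_).trans ?_
  · split_ifs with h
    · have h1 : ((s / p : ℕ) : ℝ) ≤ s / p := Nat.cast_div_le
      calc ((s / p : ℕ) : ℝ) * inertWeight β p ≤ s / p * (2 * Real.log p) := by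
            gcongr
            exact inertWeight_le h
        _ = _ := by ring
    · simp [inertWeight, h]
  · rw [← sum_filter]
    refine sum_le_sum_of_subset_of_nonneg (fun p hp => ?_) fun p _ _ => ?_
    · rw [mem_filter, mem_range] at hp
      exact mem_filter.2 ⟨mem_Ioc.2 ⟨hp.2.1.pos, hp.1.le⟩, hp.2⟩
    · have := Real.log_natCast_nonneg p
      positivity

/-- Completeness of the integer approximation: with scale `N ^ 2` the rounding of `N ^ 2 / p` loses
at most `∑ log₂ p ≤ N ^ 2` in total. -/
lemma le_scaledInertSum (β : ℤ) (n : ℕ) :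
    ((n + 1 : ℕ) : ℝ) ^ 2 * (inertSum β n / 2 - 1) ≤ scaledInertSum β ((n + 1) * (n + 1)) (n + 1) := by
  classical
  set N := n + 1
  have hterm : ∀ p ∈ range N, (if IsInert β p then (N : ℝ) ^ 2 / 2 * (Real.log p / p) else 0) - N ≤
      (((N * N) / p * inertWeight β p : ℕ) : ℝ) := by
    intro p hp
    have hpN : (p : ℝ) ≤ N := by exact_mod_cast (mem_range.1 hp).le
    split_ifs with h
    · have hw : (inertWeight β p : ℝ) ≤ N :=
        le_trans (by exact_mod_cast inertWeight_le_self β p) hpN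
      have h1 : ((N * N : ℕ) : ℝ) / p - 1 ≤ ((N * N / p : ℕ) : ℝ) := by
        rw [sub_le_iff_le_add]
        exact (Nat.lt_floor_add_one _).le.trans_eq (by rw [Nat.floor_div_natCast, Nat.floor_natCast])
      have h2 := mul_le_mul_of_nonneg_right h1 (Nat.cast_nonneg (α := ℝ) (inertWeight β p))
      have h3 : (N : ℝ) ^ 2 / 2 * (Real.log p / p) ≤ (N : ℝ) ^ 2 / p * inertWeight β p := by
        calc _ = (N : ℝ) ^ 2 / p * (Real.log p / 2) := by ring
          _ ≤ _ := by
            gcongr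
            linarith [log_le_inertWeight h]
      push_cast at h2 ⊢
      rw [← pow_two] at h2
      linarith
    · have : (0 : ℝ) ≤ (((N * N) / p * inertWeight β p : ℕ) : ℝ) := Nat.cast_nonneg _
      have : (0 : ℝ) ≤ N := Nat.cast_nonneg _
      linarith
  have hsum := sum_le_sum hterm
  rw [sum_sub_distrib, ← sum_filter, ← mul_sum, sum_const, card_range, nsmul_eq_mul] at hsum
  have hsub : inertSum β n ≤ ∑ p ∈ range N with IsInert β p, Real.log p / p := by
    refine sum_le_sum_of_subset_of_nonneg (fun p hp => ?_) fun p _ _ => ?_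
    · rw [mem_filter, mem_Ioc] at hp
      exact mem_filter.2 ⟨mem_range.2 (Nat.lt_succ_of_le hp.1.2), hp.2⟩
    · exact div_nonneg (Real.log_natCast_nonneg _) (Nat.cast_nonneg _)
  have h4 := mul_le_mul_of_nonneg_left hsub (by positivity : (0 : ℝ) ≤ (N : ℝ) ^ 2 / 2)
  rw [scaledInertSum, Nat.cast_sum]
  linarith

lemma exists_lt_scaledInertSum {β : ℤ} (hβ : ¬ IsSquare (-β)) (K : ℕ) :
    ∃ N, K * (N * N) < scaledInertSum β (N * N) N := by
  obtain ⟨n, hn⟩ := ((tendsto_inertSum hβ).eventually_ge_atTop (2 * (K + 2))).exists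
  refine ⟨n + 1, ?_⟩
  have h := le_scaledInertSum β n
  have h0 : (0 : ℝ) < ((n + 1 : ℕ) : ℝ) ^ 2 := by positivity
  have h2 : ((n + 1 : ℕ) : ℝ) ^ 2 * (K + 1) ≤ ((n + 1 : ℕ) : ℝ) ^ 2 * (inertSum β n / 2 - 1) := by
    gcongr
    linarith
  have h3 : (K * ((n + 1 : ℕ) * (n + 1 : ℕ)) : ℝ) <
      scaledInertSum β ((n + 1) * (n + 1)) (n + 1) := by
    nlinarith
  exact_mod_cast h3

/-- Once the integer approximation to the inert sum is large, `F β a b c d n` has a prime factor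
larger than `M * n`. -/
theorem exists_prime_gt_of_lt_scaledInertSum :
    ∃ C₀ : ℕ, ∀ (M : ℕ) (β : ℤ) (a b : ℚ) (c d N n : ℕ), ¬ IsSquare (-β) →
      0 ≤ a → a < b → 0 < c → N < n →
      C₀ * height M β (ratCode a) (ratCode b) c d ^ 7 * (N * N) < scaledInertSum β (N * N) N →
      ∃ p : ℕ, p.Prime ∧ M * n < p ∧ (p : ℤ) ∣ F β a b c d n := by
  obtain ⟨C, hC⟩ := exists_inertSum_le
  obtain ⟨C₀, hC₀⟩ := exists_nat_ge (2 * C)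
  refine ⟨C₀, fun M β a b c d N n hβ ha hab hc hNn hN => ?_⟩
  by_contra! hcon
  have hne : ∀ k : ℕ, (k : ℤ) ^ 2 + β ≠ 0 := fun k hk => hβ ⟨k, by linarith⟩
  have hle := hC M β a b c d n hne ha hab hc (by omega)
    fun p hp hpF => not_lt.1 fun h => hcon p hp h hpF
  have hN' := lt_of_lt_of_le (Nat.cast_lt.2 hN) (scaledInertSum_le β (N * N) N)
  set H := height M β (ratCode a) (ratCode b) c d
  have h1 : 2 * inertSum β N ≤ C₀ * (H : ℝ) ^ 7 := by
    have h2 := inertSum_mono β hNn.le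
    have h3 : 2 * C * (H : ℝ) ^ 7 ≤ C₀ * (H : ℝ) ^ 7 := by gcongr
    linarith
  have h4 := mul_le_mul_of_nonneg_left h1 (Nat.cast_nonneg (α := ℝ) (N * N))
  push_cast at hN' h4
  linarith

end QuadraticProduct

open QuadraticProduct in
/-- Effectiveness of the bound: one computable (total recursive) function `B` yields a valid bound
from the data `(M, β, a, b, c, d)`. -/
theorem mainTheorem3 :
    ∃ B : ℕ × ℤ × (ℤ × ℕ) × (ℤ × ℕ) × ℕ × ℕ → ℕ, Computable B ∧
      ∀ (M : ℕ) (β : ℤ) (a b : ℚ) (c d : ℕ),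
        ¬ IsSquare (-β) → 0 ≤ a → a < b → 0 < c →
        ∀ n : ℕ, B (M, β, QuadraticProduct.ratCode a, QuadraticProduct.ratCode b, c, d) < n →
          ∃ p : ℕ, p.Prime ∧ M * n < p ∧ (p : ℤ) ∣ QuadraticProduct.F β a b c d n := by
  classical
  obtain ⟨C₀, hC₀⟩ := exists_prime_gt_of_lt_scaledInertSum
  -- When `-β` is a square, inert primes may be lacking; `B` is total because the search then
  -- stops at once.
  have hex : ∀ z : ℕ × ℤ × (ℤ × ℕ) × (ℤ × ℕ) × ℕ × ℕ, ∃ N, IsSquare (-z.2.1) ∨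
      C₀ * height z.1 z.2.1 z.2.2.1 z.2.2.2.1 z.2.2.2.2.1 z.2.2.2.2.2 ^ 7 * (N * N) <
        scaledInertSum z.2.1 (N * N) N := by
    intro z
    by_cases h : IsSquare (-z.2.1)
    · exact ⟨0, Or.inl h⟩
    · obtain ⟨N, hN⟩ := exists_lt_scaledInertSum h
        (C₀ * height z.1 z.2.1 z.2.2.1 z.2.2.2.1 z.2.2.2.2.1 z.2.2.2.2.2 ^ 7)
      exact ⟨N, Or.inr hN⟩
  have hprim : PrimrecRel fun (z : ℕ × ℤ × (ℤ × ℕ) × (ℤ × ℕ) × ℕ × ℕ) (N : ℕ) =>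
      IsSquare (-z.2.1) ∨
      C₀ * height z.1 z.2.1 z.2.2.1 z.2.2.2.1 z.2.2.2.2.1 z.2.2.2.2.2 ^ 7 * (N * N) <
        scaledInertSum z.2.1 (N * N) N := by
    have hpow : Primrec₂ ((· ^ ·) : ℕ → ℕ → ℕ) := Primrec₂.unpaired'.1 Nat.Primrec.pow
    have hb : Primrec fun z : ℕ × ℤ × (ℤ × ℕ) × (ℤ × ℕ) × ℕ × ℕ =>
        C₀ * height z.1 z.2.1 z.2.2.1 z.2.2.2.1 z.2.2.2.2.1 z.2.2.2.2.2 ^ 7 :=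
      Primrec.nat_mul.comp (Primrec.const C₀) (hpow.comp primrec_height (Primrec.const 7))
    have hβ : Primrec fun w : (ℕ × ℤ × (ℤ × ℕ) × (ℤ × ℕ) × ℕ × ℕ) × ℕ => w.1.2.1 :=
      Primrec.fst.comp (Primrec.snd.comp Primrec.fst)
    have hN : Primrec fun w : (ℕ × ℤ × (ℤ × ℕ) × (ℤ × ℕ) × ℕ × ℕ) × ℕ => w.2 := Primrec.snd
    have hNN : Primrec fun w : (ℕ × ℤ × (ℤ × ℕ) × (ℤ × ℕ) × ℕ × ℕ) × ℕ => w.2 * w.2 :=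
      Primrec.nat_mul.comp hN hN
    have hS := primrec_scaledInertSum.comp (Primrec.pair hβ hNN) hN
    exact (primrecPred_isSquare_neg.comp hβ).or
      (Primrec.nat_lt.comp (Primrec.nat_mul.comp (hb.comp Primrec.fst) hNN) hS)
  refine ⟨fun z => Nat.find (hex z), hprim.computable_find hex, ?_⟩
  intro M β a b c d hβ ha hab hc n hn
  exact hC₀ M β a b c d _ n hβ ha hab hc hn
    ((Nat.find_spec (hex (M, β, ratCode a, ratCode b, c, d))).resolve_left hβ)
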